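/- **Setting.** Let $m\ge 1$, let $F=(f_1,\dots,f_m):\mathbb R^n\to\mathbb R^m$ be continuously differentiable, and let $\Omega=[l,u]\subseteq\mathbb R^n$ be a box whose bounds may be infinite. For $a,b\in\mathbb R^m$, $a\le b$ is meant componentwise, and $a\lneqq b$ means $a\le b$ and $a\ne b$; $y$ dominates $x$ if $F(y)\lneqq F(x)$. For nonempty $I\subseteq\{1,\dots,m\}$ and $x\in\Omega$, let $\theta^I(x)$ and $v^I(x)$ be the minimum value and the unique minimizer of $\max_{j\in I}\nabla f_j(x)^\top d+\tfrac12\|d\|^2$ over all $d$ with $x+d\in\Omega$. Write $\theta,v$ for $I=\{1,\dots,m\}$, $D(x,d)=\max_j\nabla f_j(x)^\top d$ and $\Theta(X)=\inf_{x\in X}\theta(x)$. A point $\bar x\in\Omega$ is Pareto-stationary if $\min_{d}\max_j\nabla f_j(\bar x)^\top d=0$, the minimum being over the feasible directions $d$ at $\bar x$ (those with $\bar x+td\in\Omega$ for all $t\in[0,\bar t\,]$, for some $\bar t>0$). Given a reference point $\zeta\in\mathbb R^m$, $V_F(X)$ is the Lebesgue measure of $\{y\in\mathbb R^m: \exists x\in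 X,\ F(x)\le y\le\zeta\}$; whenever the algorithm below compares hyper-volumes, $\zeta_j$ is the maximum of $f_j$ over all solutions generated so far (the points of $X^0$ and all points $z_p$ and $z_p+\alpha v^I(z_p)$ below). **Algorithm (FPD_NMT).** Parameters: $\alpha_0\in(0,1]$, $\delta,\gamma\in(0,1)$, $\sigma_k\ge 0$, $M\in\mathbb N$. Start from a finite set $X^0\subseteq\Omega$ of mutually nondominated points and $C^{-1}=\emptyset$. At iteration $k=0,1,2,\dots$: 1. Choose $X^{l(k)}$ with the lowest hyper-volume among $X^k,X^{k-1},\dots,X^{k-\min\{k,M\}}$. Let $\bar C^k$ be the set of points of $X^{l(k)}\cup C^{k-1}$ that no point of this union dominates, let $C^k=\bar C^k\cup\{x\in X^k:\forall y\in\bar C^k\ \exists j,\ f_j(y)<f_j(x)\}$, and set $\hat X=C^k$. 2. Process the points $x_p\in X^k$ one after the other. If some point of $\hat X$ dominates $x_p$, skip it. Otherwise: - If $\theta(x_p)\ge-\sigma_k$, let $\alpha=0$. If $\theta(x_p)<-\sigma_k$, let $\alpha$ be the largest number of the form $\alpha_0\delta^h$, $h\in\mathbb N$, for which some $c\in\hat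 X$ satisfies $F(x_p)\le F(c)$ and $F(x_p+\alpha v(x_p))\le F(c)+\gamma\alpha D(x_p,v(x_p))\mathbf 1$; if no $c\in\hat X$ satisfies $F(x_p)\le F(c)$, use instead the condition $F(x_p+\alpha v(x_p))\le F(x_p)+\gamma\alpha D(x_p,v(x_p))\mathbf 1$. - Add $z_p=x_p+\alpha v(x_p)$ to $\hat X$ and remove from $\hat X$ the points that $z_p$ dominates. - For each nonempty $I\subseteq\{1,\dots,m\}$ with $\theta^I(z_p)<0$, in some order: if $z_p$ is still in $\hat X$, let $\alpha$ be the largest number of the form $\alpha_0\delta^h$, $h\in\mathbb N$, such that for all $y\in\hat X$ there is $j$ with $f_j(z_p+\alpha v^I(z_p))<f_j(y)$; add $z_p+\alpha v^I(z_p)$ to $\hat X$ and remove from $\hat X$ the points that it dominates. 3. Let $\hat X^k$ be the resulting set $\hat X$. Choose $\bar X^{l(k)}$ with the lowest hyper-volume among $\hat X^k$ and $X^k,X^{k-1},\dots,X^{k-\min\{k,M-1\}}$ (only $\hat X^k$ if $M=0$). Let $X^{k+1}$ be the set of points of $\hat X^k\cup\bar X^{l(k)}$ that no point of this union dominates. **Statement.**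 Let $\{X^k\}$ be the sequence of sets produced by an infinite run of the algorithm. Assume that - at each iteration $k$ the first point to be processed belongs to $\operatorname{argmin}_{x\in X^k}\theta(x)$; - $\bar X^{l(k-1)}=X^{l(k)}$ for all $k>0$; - for some $x_0\in X^0$ the set $\mathcal L(x_0)=\bigcup_{j=1}^m\{x\in\Omega: f_j(x)\le f_j(x_0)\}$ is compact; - $\sigma_k\to0$. Then there is an infinite set $K\subseteq\mathbb N$ with $\lim_{k\in K,\,k\to\infty}\Theta(X^k)=0$. Moreover, for every such $K$ and every sequence $\{x^k\}$ with $x^k\in X^k$ for all $k$, the subsequence $\{x^k\}_K$ has accumulation points, and every accumulation point $\bar x$ of it is Pareto-stationary, with $\theta(\bar x)=0$. -/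

import Mathlib

open Filter Topology MeasureTheory

noncomputable section

namespace FrontDescent

/-- The decision space `ℝⁿ` with the Euclidean norm. The objective space `ℝᵐ` is `Fin m → ℝ`, whose
order `≤` is the componentwise one. -/
abbrev E (n : ℕ) : Type := EuclideanSpace ℝ (Fin n)

/-- The data of a box-constrained multi-objective problem and the parameters of the algorithm. The
bounds may be infinite. -/
structure Params (n m : ℕ) where
  /-- the objective function -/
  F : E n → Fin m → ℝ
  /-- lower bounds of the box -/
  lo : Fin n → EReal
  /-- upper bounds of the box -/
  up : Fin n → EReal
  /-- initial step size of the line searches -/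
  α₀ : ℝ
  /-- contraction factor of the line searches -/
  δ : ℝ
  /-- sufficient decrease parameter -/
  γ : ℝ
  /-- approximation degrees for Pareto stationarity -/
  σ : ℕ → ℝ
  /-- memory of the nonmonotone strategy -/
  M : ℕ

variable {n m : ℕ}

/-! ### Pareto dominance -/

/-- `y` dominates `x`: `F y ≤ F x` componentwise and `F y ≠ F x`. -/
def Dominates (F : E n → Fin m → ℝ) (y x : E n) : Prop := F y ≤ F x ∧ F y ≠ F x

/-- A set of mutually nondominated points with respect to `F`. -/
def MutuallyNondominated (F : E n → Fin m → ℝ) (S : Set (E n)) : Prop :=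
  ∀ x ∈ S, ∀ y ∈ S, ¬ Dominates F y x

/-- The points of `S` that no point of `S` dominates. -/
def nondominatedPart (F : E n → Fin m → ℝ) (S : Set (E n)) : Set (E n) :=
  {x | x ∈ S ∧ ∀ y ∈ S, ¬ Dominates F y x}

/-! ### Hyper-volume -/

/-- The region dominated by `Y` up to the reference point `ζ`. -/
def dominatedRegion (ζ : Fin m → ℝ) (Y : Set (Fin m → ℝ)) : Set (Fin m → ℝ) :=
  {y | ∃ ybar ∈ Y, ybar ≤ y ∧ y ≤ ζ}

/-- The hyper-volume `V_F(S)` of the image of `S` under `F`, with reference point `ζ`. -/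
def hypervolume (F : E n → Fin m → ℝ) (ζ : Fin m → ℝ) (S : Set (E n)) : ENNReal :=
  volume (dominatedRegion ζ (F '' S))

/-- The reference point whose `j`-th entry is the maximum of `f_j` over `A`
(used for finite non-empty `A` only). -/
def refPoint (F : E n → Fin m → ℝ) (A : Set (E n)) : Fin m → ℝ :=
  fun j => sSup ((fun x => F x j) '' A)

/-! ### Stationarity and projected directions -/

namespace Params

variable (P : Params n m)

/-- The feasible set: the box `[lo, up]`. -/
def Ω : Set (E n) := {x | ∀ i, P.lo i ≤ (x i : EReal) ∧ (x i : EReal) ≤ P.up i}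

/-- `max_{j ∈ I} ∇f_j(x)ᵀ d` (used for non-empty `I` only). -/
def maxSlope (I : Finset (Fin m)) (x d : E n) : ℝ :=
  ⨆ j : I, inner ℝ (gradient (fun y => P.F y j) x) d

/-- `D(x, d) = max_j ∇f_j(x)ᵀ d`. -/
def D (x d : E n) : ℝ := P.maxSlope Finset.univ x d

/-- The objective `max_{j ∈ I} ∇f_j(x)ᵀ d + ‖d‖² / 2` of the direction-finding problem. -/
def model (I : Finset (Fin m)) (x d : E n) : ℝ := P.maxSlope I x d + 1 / 2 * ‖d‖ ^ 2

/-- The steps `d` with `x + d` in the box. -/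
def steps (x : E n) : Set (E n) := {d | x + d ∈ P.Ω}

/-- The optimal value `θ^I(x)` of the direction-finding problem. -/
def θI (I : Finset (Fin m)) (x : E n) : ℝ := sInf (P.model I x '' P.steps x)

/-- The projected partial descent direction `v^I(x)`: the minimizer of the direction-finding problem
(for feasible `x` and non-empty `I` it exists and is unique, by strong convexity). -/
def vI (I : Finset (Fin m)) (x : E n) : E n :=
  Classical.epsilon fun d => d ∈ P.steps x ∧ IsMinOn (P.model I x) (P.steps x) d

/-- `θ(x)`, the case `I = {1, …, m}`. -/
def θ (x : E n) : ℝ := P.θI Finset.univ x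

/-- The projected common descent direction `v(x)`, the case `I = {1, …, m}`. -/
def v (x : E n) : E n := P.vI Finset.univ x

/-- `Θ(S) = inf_{x ∈ S} θ(x)`. -/
def Θ (S : Set (E n)) : ℝ := sInf (P.θ '' S)

/-- The feasible directions at `x`. -/
def feasibleDirections (x : E n) : Set (E n) :=
  {d | ∃ tbar : ℝ, 0 < tbar ∧ ∀ t ∈ Set.Icc 0 tbar, x + t • d ∈ P.Ω}

/-- Pareto stationarity of a feasible point: the minimum of `max_j ∇f_j(x)ᵀ d` over the feasible
directions `d` is (attained and equal to) `0`. -/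
def ParetoStationary (x : E n) : Prop :=
  x ∈ P.Ω ∧ IsLeast (P.D x '' P.feasibleDirections x) 0

/-- The set `𝓛(x₀)`, the union over `j` of the feasible sublevel sets of `f_j` at level `f_j(x₀)`. -/
def levelUnion (x₀ : E n) : Set (E n) := ⋃ j, {x | x ∈ P.Ω ∧ P.F x j ≤ P.F x₀ j}

end Params

/-! ### The algorithm -/

/-- A loop over a list: `Sweep step L s t` says that processing the entries of `L` in their order,
each by a transition of `step`, can lead from state `s` to state `t`. -/
inductive Sweep {ι S : Type} (step : ι → S → S → Prop) : List ι → S → S → Prop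
  | nil (s : S) : Sweep step [] s s
  | cons {a : ι} {L : List ι} {s t r : S} :
      step a s t → Sweep step L t r → Sweep step (a :: L) s r

/-- The state inside an iteration: the current set `X̂` and all solutions generated so far. -/
structure State (n : ℕ) where
  /-- the current set `X̂` -/
  Xhat : Set (E n)
  /-- all solutions generated since the start of the algorithm -/
  gen : Set (E n)

/-- Add the new point `z` to `X̂` and remove the points that it dominates. -/
def State.add (F : E n → Fin m → ℝ) (s : State n) (z : E n) : State n where
  Xhat := (s.Xhat ∪ {z}) \ {y | y ∈ s.Xhat ∧ Dominates F z y}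
  gen := s.gen ∪ {z}

namespace Params

variable (P : Params n m)

/-- The nonmonotone Armijo-type line search at `x`, with result `α`. -/
def LineSearch (Xhat : Set (E n)) (x : E n) (α : ℝ) : Prop :=
  ((∃ c ∈ Xhat, P.F x ≤ P.F c) →
    IsGreatest {a | ∃ h : ℕ, a = P.α₀ * P.δ ^ h ∧ ∃ c ∈ Xhat, P.F x ≤ P.F c ∧
      ∀ j, P.F (x + a • P.v x) j ≤ P.F c j + P.γ * a * P.D x (P.v x)} α) ∧
  ((¬ ∃ c ∈ Xhat, P.F x ≤ P.F c) →
    IsGreatest {a | ∃ h : ℕ, a = P.α₀ * P.δ ^ h ∧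
      ∀ j, P.F (x + a • P.v x) j ≤ P.F x j + P.γ * a * P.D x (P.v x)} α)

/-- The step size `α` of phase 1 at `x`, with approximation degree `σ`. -/
def RefineStepSize (σ : ℝ) (Xhat : Set (E n)) (x : E n) (α : ℝ) : Prop :=
  (P.θ x < -σ → P.LineSearch Xhat x α) ∧ (¬ P.θ x < -σ → α = 0)

/-- The line search of phase 2 at `z` along `v^I(z)`, with result `α`. -/
def PartialLineSearch (I : Finset (Fin m)) (Xhat : Set (E n)) (z : E n) (α : ℝ) : Prop :=
  IsGreatest {a | ∃ h : ℕ, a = P.α₀ * P.δ ^ h ∧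
    ∀ y ∈ Xhat, ∃ j, P.F (z + a • P.vI I z) j < P.F y j} α

/-- Phase 2 at `z` for one index set `I`. -/
def EnrichStep (z : E n) (I : Finset (Fin m)) (s t : State n) : Prop :=
  (z ∈ s.Xhat → ∃ α, P.PartialLineSearch I s.Xhat z α ∧ t = s.add P.F (z + α • P.vI I z)) ∧
  (z ∉ s.Xhat → t = s)

/-- The processing of one point `x` of the current set: if no point of `X̂` dominates it, phase 1
produces `z`, and phase 2 then runs, in some order, through the non-empty index sets `I` with
`θ^I(z) < 0`. -/
def ProcessPoint (σ : ℝ) (x : E n) (s t : State n) : Prop :=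
  ((¬ ∃ y ∈ s.Xhat, Dominates P.F y x) →
    ∃ (α : ℝ) (z : E n) (Is : List (Finset (Fin m))),
      P.RefineStepSize σ s.Xhat x α ∧ z = x + α • P.v x ∧
      Is.Nodup ∧ (∀ I, I ∈ Is ↔ I.Nonempty ∧ P.θI I z < 0) ∧
      Sweep (P.EnrichStep z) Is (s.add P.F z) t) ∧
  ((∃ y ∈ s.Xhat, Dominates P.F y x) → t = s)

end Params

/-- An infinite run of the nonmonotone front projected descent algorithm. -/
structure Run (P : Params n m) where
  /-- the iterate sets `X^k` -/
  X : ℕ → Set (E n)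
  /-- the index `l(k)` -/
  l : ℕ → ℕ
  /-- the filtered sets `C̄^k` -/
  Cbar : ℕ → Set (E n)
  /-- the reference sets `C^k` -/
  C : ℕ → Set (E n)
  /-- the order in which the points of `X^k` are processed -/
  order : ℕ → List (E n)
  /-- the set `X̂^k` after all the points of `X^k` have been processed -/
  Xhat : ℕ → Set (E n)
  /-- the set of lowest hyper-volume chosen at the end of iteration `k` -/
  Xbar : ℕ → Set (E n)
  /-- all solutions generated before iteration `k` -/
  gen : ℕ → Set (E n)
  gen_zero : gen 0 = X 0
  /-- `l(k)` is one of `k, k - 1, …, k - min{k, M}` -/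
  l_range : ∀ k, l k ≤ k ∧ k ≤ l k + P.M
  /-- `X^{l(k)}` has the lowest hyper-volume among `X^k, …, X^{k - min{k, M}}` -/
  l_argmin : ∀ k i, i ≤ k → k ≤ i + P.M →
    hypervolume P.F (refPoint P.F (gen k)) (X (l k)) ≤
      hypervolume P.F (refPoint P.F (gen k)) (X i)
  /-- `C^{-1}` is empty -/
  Cbar_zero : Cbar 0 = nondominatedPart P.F (X (l 0) ∪ ∅)
  Cbar_succ : ∀ k, Cbar (k + 1) = nondominatedPart P.F (X (l (k + 1)) ∪ C k)
  C_eq : ∀ k, C k = Cbar k ∪ {x | x ∈ X k ∧ ∀ y ∈ Cbar k, ∃ j, P.F y j < P.F x j}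
  order_nodup : ∀ k, (order k).Nodup
  mem_order : ∀ k x, x ∈ order k ↔ x ∈ X k
  /-- the for-loop over the points of `X^k`, started from `X̂^k = C^k` -/
  sweep : ∀ k, Sweep (P.ProcessPoint (P.σ k)) (order k) ⟨C k, gen k⟩ ⟨Xhat k, gen (k + 1)⟩
  /-- the candidates are `X̂^k` and `X^k, …, X^{k - min{k, M - 1}}` -/
  Xbar_mem : ∀ k, Xbar k = Xhat k ∨ ∃ i, i ≤ k ∧ k < i + P.M ∧ Xbar k = X i
  Xbar_le_Xhat : ∀ k, hypervolume P.F (refPoint P.F (gen (k + 1))) (Xbar k) ≤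
    hypervolume P.F (refPoint P.F (gen (k + 1))) (Xhat k)
  Xbar_le_X : ∀ k i, i ≤ k → k < i + P.M →
    hypervolume P.F (refPoint P.F (gen (k + 1))) (Xbar k) ≤
      hypervolume P.F (refPoint P.F (gen (k + 1))) (X i)
  X_succ : ∀ k, X (k + 1) = nondominatedPart P.F (Xhat k ∪ Xbar k)

/-- At each iteration, the first point to be processed minimizes `θ` over `X^k`. -/
def Run.FirstIsArgmin {P : Params n m} (R : Run P) : Prop :=
  ∀ k, ∀ x ∈ (R.order k).head?, ∀ y ∈ R.X k, P.θ x ≤ P.θ y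

/-- For every `k > 0`, the set of lowest hyper-volume chosen at the end of iteration `k - 1` is the
one chosen at the start of iteration `k`. -/
def Run.SameSet {P : Params n m} (R : Run P) : Prop :=
  ∀ k, 0 < k → R.Xbar (k - 1) = R.X (R.l k)

end FrontDescent

end

namespace FrontDescent

variable {n m : ℕ}

/-! ### The direction-finding problem: feasibility, existence and size of minimizers -/

namespace Params
variable (P : Params n m)

/-! Let W_k be the hyper-volume of `X^{l(k)}` at the reference point of iteration k (`worstVolume`).
The argument is that W_k is nondecreasing and bounded, while every iteration with `Θ(X^k) ≤ -ε` and
`σ_k < ε` makes `X^{k+1}` exceed W_k by a fixed amount.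

Monotonicity rests on weak domination (`Covers`): `X^{k+1}` covers `C^k`, which contains `C̄^k`,
which covers `X^{l(k)}`. Reference points only grow. Boundedness holds because every generated
solution stays in the compact set `𝓛(x₀)` (`Run.invariants`).

For the fixed gain (`exists_volume_increase`), `Xbar^{k-1} = X^{l(k)}` makes `X^k` cover `C^k`
(`covers_X_C`), so the first processed point x, a minimizer of `θ`, is not skipped. Compactness
bounds its step size below (`exists_uniform_armijo_step`), so the new point improves every objective
of some `c ∈ C^k` by at least a fixed η. No point of `C̄^k` lies below c with a different image
(`eq_of_mem_Cbar_of_le`), so a cube of side η below `F c` is newly dominated: the gain is at least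
`η ^ m`.

If `k + 1 = l(i)`, this gain is inherited by W_i, which is impossible for large k since W converges.
Hence `K = {k | ∃ i, l(i) = k + 1}`, infinite because `l(i) ≥ i - M`, has `Θ(X^k) → 0`. For any such
K, `Θ(X^k) ≤ θ(x^k) ≤ 0` squeezes `θ(x^k)` to 0, and upper semicontinuity of `θ` gives `θ = 0` at
accumulation points. -/

theorem isClosed_Ω : IsClosed P.Ω := by
  simp only [Ω, Set.ofPred_forall]
  refine isClosed_iInter fun i => ?_
  have hc : Continuous fun x : E n => ((x i : ℝ) : EReal) :=
    continuous_coe_real_ereal.comp (by fun_prop)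
  exact (isClosed_le continuous_const hc).inter (isClosed_le hc continuous_const)

theorem add_smul_mem_Ω {x d : E n} (hx : x ∈ P.Ω) (hd : x + d ∈ P.Ω) {a : ℝ} (ha0 : 0 ≤ a)
    (ha1 : a ≤ 1) : x + a • d ∈ P.Ω := by
  intro i
  obtain ⟨h1, h2⟩ := hx i
  obtain ⟨h3, h4⟩ := hd i
  simp only [PiLp.add_apply, PiLp.smul_apply, smul_eq_mul] at h3 h4 ⊢
  rcases le_total 0 (d i) with h | h
  · exact ⟨h1.trans (EReal.coe_le_coe_iff.2 (by nlinarith)),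
      le_trans (EReal.coe_le_coe_iff.2 (by nlinarith)) h4⟩
  · exact ⟨h3.trans (EReal.coe_le_coe_iff.2 (by nlinarith)),
      le_trans (EReal.coe_le_coe_iff.2 (by nlinarith)) h2⟩

theorem zero_mem_steps {x : E n} (hx : x ∈ P.Ω) : (0 : E n) ∈ P.steps x := by
  simpa [steps] using hx

theorem isClosed_steps (x : E n) : IsClosed (P.steps x) :=
  P.isClosed_Ω.preimage (continuous_const.add continuous_id)

variable {P}

theorem continuous_gradient (hF : ContDiff ℝ 1 P.F) (j : Fin m) :
    Continuous (gradient fun y => P.F y j) :=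
  (InnerProductSpace.toDual ℝ (E n)).symm.continuous.comp
    ((contDiff_pi.1 hF j).continuous_fderiv one_ne_zero)

theorem inner_le_maxSlope {I : Finset (Fin m)} {j : Fin m} (hj : j ∈ I) (x d : E n) :
    inner ℝ (gradient (fun y => P.F y j) x) d ≤ P.maxSlope I x d :=
  le_ciSup (f := fun j : I => inner ℝ (gradient (fun y => P.F y j) x) d)
    (Set.finite_range _).bddAbove ⟨j, hj⟩

theorem continuous_maxSlope (hF : ContDiff ℝ 1 P.F) {I : Finset (Fin m)} (hI : I.Nonempty) :
    Continuous fun p : E n × E n => P.maxSlope I p.1 p.2 := by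
  have : Nonempty I := hI.to_subtype
  simp only [maxSlope, ← Finset.sup'_univ_eq_ciSup]
  exact Continuous.finset_sup'_apply _ fun j _ =>
    ((continuous_gradient hF j).comp continuous_fst).inner continuous_snd

theorem maxSlope_smul {I : Finset (Fin m)} (x d : E n) {t : ℝ} (ht : 0 ≤ t) :
    P.maxSlope I x (t • d) = t * P.maxSlope I x d := by
  simp only [maxSlope, inner_smul_right, Real.mul_iSup_of_nonneg ht]

theorem maxSlope_zero {I : Finset (Fin m)} (x : E n) : P.maxSlope I x 0 = 0 := by
  simpa using maxSlope_smul (P := P) (I := I) x 0 le_rfl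

theorem model_zero (I : Finset (Fin m)) (x : E n) : P.model I x 0 = 0 := by
  simp [model, maxSlope_zero]

theorem continuous_model (hF : ContDiff ℝ 1 P.F) {I : Finset (Fin m)} (hI : I.Nonempty) :
    Continuous fun p : E n × E n => P.model I p.1 p.2 :=
  (continuous_maxSlope hF hI).add (continuous_const.mul (continuous_snd.norm.pow 2))

/-- Cauchy–Schwarz for a single index of `I`. The quadratic growth gives both coercivity of the
model and the bound on its minimizer. -/
theorem model_lower {I : Finset (Fin m)} {j : Fin m} (hj : j ∈ I) (x d : E n) :
    1 / 2 * ‖d‖ ^ 2 - ‖gradient (fun y => P.F y j) x‖ * ‖d‖ ≤ P.model I x d := by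
  have h1 := inner_le_maxSlope (P := P) hj x d
  have h2 := neg_le_of_abs_le (abs_real_inner_le_norm (gradient (fun y => P.F y j) x) d)
  simp only [model]
  linarith

theorem exists_minimizer (hF : ContDiff ℝ 1 P.F) {I : Finset (Fin m)} (hI : I.Nonempty) {x : E n}
    (hx : x ∈ P.Ω) : ∃ d, d ∈ P.steps x ∧ IsMinOn (P.model I x) (P.steps x) d := by
  obtain ⟨j, hj⟩ := hI
  have hc : ContinuousOn (P.model I x) (P.steps x) :=
    ((continuous_model hF ⟨j, hj⟩).comp (Continuous.prodMk_right x)).continuousOn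
  -- Outside the ball of radius twice the gradient norm the model is nonnegative, hence no better
  -- than `d = 0`.
  have hev : ∀ᶠ d in cocompact (E n), P.model I x 0 ≤ P.model I x d := by
    filter_upwards [(tendsto_norm_cocompact_atTop (E := E n)).eventually_ge_atTop
      (2 * ‖gradient (fun y => P.F y j) x‖)] with d hd
    have h := model_lower (P := P) hj x d
    rw [model_zero]
    have h2 := mul_le_mul_of_nonneg_right hd (norm_nonneg d)
    rw [sq] at h
    linarith
  exact hc.exists_isMinOn' (P.isClosed_steps x) (P.zero_mem_steps hx) (hev.filter_mono inf_le_left)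

theorem vI_spec (hF : ContDiff ℝ 1 P.F) {I : Finset (Fin m)} (hI : I.Nonempty) {x : E n}
    (hx : x ∈ P.Ω) : P.vI I x ∈ P.steps x ∧ IsMinOn (P.model I x) (P.steps x) (P.vI I x) :=
  Classical.epsilon_spec (exists_minimizer hF hI hx)

theorem isLeast_θI (hF : ContDiff ℝ 1 P.F) {I : Finset (Fin m)} (hI : I.Nonempty) {x : E n}
    (hx : x ∈ P.Ω) : IsLeast (P.model I x '' P.steps x) (P.model I x (P.vI I x)) := by
  obtain ⟨h1, h2⟩ := vI_spec hF hI hx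
  refine ⟨⟨_, h1, rfl⟩, ?_⟩
  rintro _ ⟨d, hd, rfl⟩
  exact h2 hd

theorem θI_eq (hF : ContDiff ℝ 1 P.F) {I : Finset (Fin m)} (hI : I.Nonempty) {x : E n}
    (hx : x ∈ P.Ω) : P.θI I x = P.model I x (P.vI I x) :=
  (isLeast_θI hF hI hx).csInf_eq

theorem θI_le_model (hF : ContDiff ℝ 1 P.F) {I : Finset (Fin m)} (hI : I.Nonempty) {x d : E n}
    (hx : x ∈ P.Ω) (hd : d ∈ P.steps x) : P.θI I x ≤ P.model I x d := by
  rw [θI_eq hF hI hx]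
  exact (isLeast_θI hF hI hx).2 ⟨d, hd, rfl⟩

theorem θI_nonpos (hF : ContDiff ℝ 1 P.F) {I : Finset (Fin m)} (hI : I.Nonempty) {x : E n}
    (hx : x ∈ P.Ω) : P.θI I x ≤ 0 :=
  (θI_le_model hF hI hx (P.zero_mem_steps hx)).trans_eq (model_zero I x)

/-- Dropping the nonnegative quadratic term turns a bound `θ ≤ -ε` into a bound on the slope used in
the line search. -/
theorem maxSlope_vI_le (hF : ContDiff ℝ 1 P.F) {I : Finset (Fin m)} (hI : I.Nonempty) {x : E n}
    (hx : x ∈ P.Ω) : P.maxSlope I x (P.vI I x) ≤ P.θI I x := by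
  rw [θI_eq hF hI hx, model]
  linarith [sq_nonneg ‖P.vI I x‖]

theorem norm_vI_le (hF : ContDiff ℝ 1 P.F) {I : Finset (Fin m)} {j : Fin m} (hj : j ∈ I)
    {x : E n} (hx : x ∈ P.Ω) : ‖P.vI I x‖ ≤ 2 * ‖gradient (fun y => P.F y j) x‖ := by
  have h1 := θI_nonpos hF ⟨j, hj⟩ hx
  rw [θI_eq hF ⟨j, hj⟩ hx] at h1
  have h2 := model_lower (P := P) hj x (P.vI I x)
  by_contra! h
  nlinarith [norm_nonneg (gradient (fun y => P.F y j) x), norm_nonneg (P.vI I x)]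

/-! ### A step size uniform over compact sets -/

/-- Mean value estimate with the gradient oscillation along the segment. -/
theorem objective_step_le (hF : ContDiff ℝ 1 P.F) (j : Fin m) {x d : E n} {ω : ℝ}
    (hω : ∀ y ∈ segment ℝ x (x + d),
      ‖gradient (fun y => P.F y j) y - gradient (fun y => P.F y j) x‖ ≤ ω) :
    P.F (x + d) j ≤ P.F x j + inner ℝ (gradient (fun y => P.F y j) x) d + ω * ‖d‖ := by
  have hdiff : Differentiable ℝ fun y => P.F y j :=
    (contDiff_pi.1 hF j).differentiable one_ne_zero
  have h := (convex_segment x (x + d)).norm_image_sub_le_of_norm_hasFDerivWithin_le'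
    (f := fun y => P.F y j) (f' := fun y => fderiv ℝ (fun y => P.F y j) y)
    (φ := fderiv ℝ (fun y => P.F y j) x) (C := ω)
    (fun y _ => (hdiff y).hasFDerivAt.hasFDerivWithinAt)
    (fun y hy => by
      have := hω y hy
      rwa [gradient, gradient, ← map_sub, LinearIsometryEquiv.norm_map] at this)
    (left_mem_segment ℝ x (x + d)) (right_mem_segment ℝ x (x + d))
  have h2 : inner ℝ (gradient (fun y => P.F y j) x) d = fderiv ℝ (fun y => P.F y j) x d := by
    simp [gradient]
  rw [h2]
  simp only [add_sub_cancel_left] at h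
  have := (abs_le.1 (by simpa [Real.norm_eq_abs] using h)).2
  linarith

/-- A step size that satisfies the Armijo condition at all points of a compact set where `θ` is
bounded away from zero. -/
theorem exists_uniform_armijo_step (hm : 0 < m) (hF : ContDiff ℝ 1 P.F)
    (hα₀ : 0 < P.α₀) (hδ : 0 < P.δ ∧ P.δ < 1) (hγ : P.γ < 1)
    {L : Set (E n)} (hL : IsCompact L) (hLΩ : L ⊆ P.Ω) {ε : ℝ} (hε : 0 < ε) :
    ∃ h : ℕ, ∀ x ∈ L, P.θ x ≤ -ε → ∀ j,
      P.F (x + (P.α₀ * P.δ ^ h) • P.v x) j ≤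
        P.F x j + P.γ * (P.α₀ * P.δ ^ h) * P.D x (P.v x) := by
  have hI : (Finset.univ : Finset (Fin m)).Nonempty := ⟨⟨0, hm⟩, Finset.mem_univ _⟩
  obtain ⟨G, hG⟩ := (hL.image_of_continuousOn
    (continuous_gradient hF ⟨0, hm⟩).norm.continuousOn).bddAbove
  -- The extra 1 keeps `R` positive, since `R` is a divisor in `ω`.
  set R : ℝ := 2 * |G| + 1 with hR
  have hRpos : 0 < R := by positivity
  have hv : ∀ x ∈ L, ‖P.v x‖ ≤ R := fun x hx => by
    have h1 := norm_vI_le hF (Finset.mem_univ (⟨0, hm⟩ : Fin m)) (hLΩ hx)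
    have h2 := hG ⟨x, hx, rfl⟩
    have h3 := le_abs_self G
    simp only [v]
    simp only at h2
    linarith
  obtain ⟨r, hr⟩ := hL.isBounded.subset_closedBall 0
  -- Radius `r + 1` leaves room for segments of length less than 1 starting in `L`.
  have hK : IsCompact (Metric.closedBall (0 : E n) (r + 1)) := isCompact_closedBall _ _
  -- Chosen so that the oscillation error `ω * ‖v‖` is at most `(1 - γ) ε`, the slack left by the
  -- Armijo condition.
  set ω : ℝ := (1 - P.γ) * ε / R with hω
  have hωpos : 0 < ω := by
    have : 0 < 1 - P.γ := by linarith
    positivity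
  have huc : ∀ j : Fin m, ∃ ρ > 0, ∀ x ∈ Metric.closedBall (0 : E n) (r + 1),
      ∀ y ∈ Metric.closedBall (0 : E n) (r + 1), dist x y < ρ →
      dist (gradient (fun y => P.F y j) x) (gradient (fun y => P.F y j) y) < ω := fun j =>
    Metric.uniformContinuousOn_iff.1
      (hK.uniformContinuousOn_of_continuous (continuous_gradient hF j).continuousOn) ω hωpos
  choose ρ hρ hρ' using huc
  obtain ⟨ρ₀, hρ₀pos, hρ₀⟩ : ∃ ρ₀ > 0, ∀ j, ρ₀ ≤ ρ j := by
    have : Nonempty (Fin m) := ⟨⟨0, hm⟩⟩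
    obtain ⟨j, hj⟩ := Finite.exists_min ρ
    exact ⟨ρ j, hρ j, hj⟩
  have ht : Tendsto (fun h : ℕ => P.α₀ * P.δ ^ h * R) atTop (𝓝 (P.α₀ * 0 * R)) :=
    ((tendsto_pow_atTop_nhds_zero_of_lt_one hδ.1.le hδ.2).const_mul _).mul_const _
  have hpos : P.α₀ * 0 * R < min ρ₀ 1 := by simpa using hρ₀pos
  obtain ⟨h, hh⟩ := (ht.eventually_lt_const hpos).exists
  refine ⟨h, fun x hx hθ j => ?_⟩
  set a : ℝ := P.α₀ * P.δ ^ h with ha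
  have hapos : 0 < a := mul_pos hα₀ (pow_pos hδ.1 h)
  have hav : ‖a • P.v x‖ < min ρ₀ 1 := by
    rw [norm_smul, Real.norm_of_nonneg hapos.le]
    exact (mul_le_mul_of_nonneg_left (hv x hx) hapos.le).trans_lt hh
  have hxr : ‖x‖ ≤ r := by simpa using hr hx
  have hstep := objective_step_le hF j (x := x) (d := a • P.v x) (ω := ω) (fun y hy => by
    have hyx : ‖y - x‖ ≤ ‖a • P.v x‖ := by
      have := norm_sub_le_of_mem_segment hy
      simpa using this
    have hy1 : ‖y - x‖ < 1 := (hyx.trans_lt hav).trans_le (min_le_right _ _)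
    have hyr : ‖y‖ ≤ r + 1 := by
      have := norm_add_le (y - x) x
      rw [sub_add_cancel] at this
      linarith
    rw [← dist_eq_norm]
    refine (hρ' j y (by simpa using hyr) x (by simp; linarith) ?_).le
    rw [dist_eq_norm]
    exact (hyx.trans_lt hav).trans_le ((min_le_left _ _).trans (hρ₀ j)))
  have h1 : inner ℝ (gradient (fun y => P.F y j) x) (P.v x) ≤ P.D x (P.v x) :=
    inner_le_maxSlope (Finset.mem_univ j) _ _
  have h2 : P.D x (P.v x) ≤ -ε := (maxSlope_vI_le hF hI (hLΩ hx)).trans hθ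
  rw [inner_smul_right, norm_smul, Real.norm_of_nonneg hapos.le] at hstep
  have h3 : ω * ‖P.v x‖ ≤ (1 - P.γ) * ε := by
    calc ω * ‖P.v x‖ ≤ ω * R := mul_le_mul_of_nonneg_left (hv x hx) hωpos.le
      _ = (1 - P.γ) * ε := by rw [hω]; field_simp
  -- Since `D ≤ -ε`, the error is at most `-(1 - γ) D`, and `D - (1 - γ) D = γ D`.
  have h4 : inner ℝ (gradient (fun y => P.F y j) x) (P.v x) + ω * ‖P.v x‖ ≤
      P.γ * P.D x (P.v x) := by nlinarith
  have h5 := mul_le_mul_of_nonneg_left h4 hapos.le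
  linarith

/-! ### Limits and stationarity -/

/-- A limit of points whose `θ` tends to zero has `θ = 0`. -/
theorem θ_eq_zero_of_tendsto (hm : 0 < m) (hF : ContDiff ℝ 1 P.F) {ι : Type*} {f : Filter ι}
    [f.NeBot] {u : ι → E n} {x : E n} (hu : ∀ i, u i ∈ P.Ω) (hux : Tendsto u f (𝓝 x))
    (hθ : Tendsto (fun i => P.θ (u i)) f (𝓝 0)) : P.θ x = 0 := by
  have hI : (Finset.univ : Finset (Fin m)).Nonempty := ⟨⟨0, hm⟩, Finset.mem_univ _⟩
  have hx : x ∈ P.Ω := P.isClosed_Ω.mem_of_tendsto hux (Eventually.of_forall hu)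
  refine le_antisymm (θI_nonpos hF hI hx) ?_
  rw [θ, θI_eq hF hI hx]
  set d := P.vI Finset.univ x
  have hd : x + d ∈ P.Ω := (vI_spec hF hI hx).1
  -- The endpoint `x + d` is kept fixed: the steps `x + d - u i` are feasible at `u i` and tend to
  -- `d`.
  have hlim : Tendsto (fun i => P.model Finset.univ (u i) (x + d - u i)) f
      (𝓝 (P.model Finset.univ x d)) := by
    have h := ((continuous_model hF hI).tendsto (x, x + d - x)).comp
      (hux.prodMk_nhds (tendsto_const_nhds.sub hux))
    simpa [Function.comp_def] using h
  refine le_of_tendsto_of_tendsto' hθ hlim fun i => θI_le_model hF hI (hu i) ?_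
  simpa [steps] using hd

/-- Compare `θ = 0` with the model at `s • d` for small `s > 0`: the slope is linear in `s` and the
penalty quadratic, so dividing by `s` and letting `s → 0` leaves a nonnegative slope. -/
theorem paretoStationary_of_θ_eq_zero (hm : 0 < m) (hF : ContDiff ℝ 1 P.F) {x : E n}
    (hx : x ∈ P.Ω) (hθ : P.θ x = 0) : P.ParetoStationary x := by
  have hI : (Finset.univ : Finset (Fin m)).Nonempty := ⟨⟨0, hm⟩, Finset.mem_univ _⟩
  refine ⟨hx, ⟨0, ⟨1, one_pos, fun t _ => by simpa using hx⟩, maxSlope_zero x⟩, ?_⟩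
  rintro _ ⟨d, ⟨t, ht, hd⟩, rfl⟩
  have hkey : ∀ s ∈ Set.Ioc 0 t, 0 ≤ P.D x d + s * (1 / 2 * ‖d‖ ^ 2) := fun s hs => by
    have h := θI_le_model hF hI hx (d := s • d) (hd s ⟨hs.1.le, hs.2⟩)
    rw [model, maxSlope_smul x d hs.1.le, norm_smul, Real.norm_of_nonneg hs.1.le] at h
    change P.θ x ≤ _ at h
    rw [hθ] at h
    have h' : 0 ≤ s * (P.D x d + s * (1 / 2 * ‖d‖ ^ 2)) := by
      simp only [D]
      linarith
    exact nonneg_of_mul_nonneg_right h' hs.1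
  have hlim : Tendsto (fun s : ℝ => P.D x d + s * (1 / 2 * ‖d‖ ^ 2)) (𝓝[>] 0)
      (𝓝 (P.D x d + 0 * (1 / 2 * ‖d‖ ^ 2))) :=
    (Continuous.tendsto (by fun_prop) 0).mono_left nhdsWithin_le_nhds
  have := ge_of_tendsto hlim (by
    filter_upwards [Ioc_mem_nhdsGT ht] with s hs using hkey s hs)
  simpa using this

end Params

/-! ### Weak domination between sets and invariants of the loops -/

/-- Every point of `B` is weakly dominated by a point of `A`. -/
def Covers (F : E n → Fin m → ℝ) (A B : Set (E n)) : Prop := ∀ b ∈ B, ∃ a ∈ A, F a ≤ F b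

theorem Covers.trans {F : E n → Fin m → ℝ} {A B C : Set (E n)} (h₁ : Covers F A B)
    (h₂ : Covers F B C) : Covers F A C := fun c hc => by
  obtain ⟨b, hb, hbc⟩ := h₂ c hc
  obtain ⟨a, ha, hab⟩ := h₁ b hb
  exact ⟨a, ha, hab.trans hbc⟩

theorem Covers.of_subset {F : E n → Fin m → ℝ} {A B : Set (E n)} (h : B ⊆ A) : Covers F A B :=
  fun b hb => ⟨b, h hb, le_rfl⟩

theorem nondominatedPart_subset {F : E n → Fin m → ℝ} {S : Set (E n)} :
    nondominatedPart F S ⊆ S := fun _ hx => hx.1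

theorem mutuallyNondominated_nondominatedPart (F : E n → Fin m → ℝ) (S : Set (E n)) :
    MutuallyNondominated F (nondominatedPart F S) := fun _ hx y hy => hx.2 y hy.1

/-- Among the finitely many points weakly below `b`, take one with minimal image: a point dominating
it would also lie below `b`. -/
theorem covers_nondominatedPart {F : E n → Fin m → ℝ} {S : Set (E n)} (hS : S.Finite) :
    Covers F (nondominatedPart F S) S := fun b hb => by
  obtain ⟨a, ⟨ha, hab⟩, hmin⟩ := (hS.subset (Set.sep_subset S fun a => F a ≤ F b)).exists_minimalFor
    F {a ∈ S | F a ≤ F b} ⟨b, hb, le_rfl⟩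
  exact ⟨a, ⟨ha, fun y hy hd => hd.2 (le_antisymm hd.1 (hmin ⟨hy, hd.1.trans hab⟩ hd.1))⟩, hab⟩

theorem MutuallyNondominated.eq_of_le {F : E n → Fin m → ℝ} {S : Set (E n)}
    (hS : MutuallyNondominated F S) {x y : E n} (hx : x ∈ S) (hy : y ∈ S) (h : F y ≤ F x) :
    F y = F x := by
  by_contra hne
  exact hS x hx y hy ⟨h, hne⟩

/-- The state `t` extends `s`: it covers the current set of `s` and has generated more solutions. -/
def State.Extends (F : E n → Fin m → ℝ) (t s : State n) : Prop :=
  Covers F t.Xhat s.Xhat ∧ s.gen ⊆ t.gen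

theorem State.Extends.refl {F : E n → Fin m → ℝ} (s : State n) : s.Extends F s :=
  ⟨Covers.of_subset subset_rfl, subset_rfl⟩

theorem State.Extends.trans {F : E n → Fin m → ℝ} {r t s : State n} (h₁ : r.Extends F t)
    (h₂ : t.Extends F s) : r.Extends F s := ⟨h₁.1.trans h₂.1, h₂.2.trans h₁.2⟩

/-- The invariant of the loops: finitely many solutions have been generated, all inside `L`, and
the current set weakly dominates `x₀`. -/
structure State.Admissible (F : E n → Fin m → ℝ) (L : Set (E n)) (x₀ : E n) (s : State n) :
    Prop where
  finite_gen : s.gen.Finite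
  Xhat_subset : s.Xhat ⊆ s.gen
  gen_subset : s.gen ⊆ L
  covers_start : ∃ c ∈ s.Xhat, F c ≤ F x₀

theorem State.mem_add (F : E n → Fin m → ℝ) (s : State n) (z : E n) : z ∈ (s.add F z).Xhat :=
  ⟨Or.inr rfl, fun h => h.2.2 rfl⟩

theorem State.add_extends (F : E n → Fin m → ℝ) (s : State n) (z : E n) :
    (s.add F z).Extends F s := by
  refine ⟨fun b hb => ?_, Set.subset_union_left⟩
  by_cases h : Dominates F z b
  · exact ⟨z, s.mem_add F z, h.1⟩
  · exact ⟨b, ⟨Or.inl hb, fun h' => h h'.2⟩, le_rfl⟩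

theorem State.Admissible.covers_start_of_extends {F : E n → Fin m → ℝ} {L : Set (E n)} {x₀ : E n}
    {s t : State n} (hs : s.Admissible F L x₀) (h : t.Extends F s) :
    ∃ c ∈ t.Xhat, F c ≤ F x₀ := by
  obtain ⟨c, hc, hcx⟩ := hs.covers_start
  obtain ⟨a, ha, hac⟩ := h.1 c hc
  exact ⟨a, ha, hac.trans hcx⟩

theorem State.Admissible.add {F : E n → Fin m → ℝ} {L : Set (E n)} {x₀ : E n}
    {s : State n} (hs : s.Admissible F L x₀) {z : E n} (hz : z ∈ L) :
    (s.add F z).Admissible F L x₀ where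
  finite_gen := hs.finite_gen.union (Set.finite_singleton z)
  Xhat_subset := Set.sdiff_subset.trans (Set.union_subset_union_left _ hs.Xhat_subset)
  gen_subset := Set.union_subset hs.gen_subset (Set.singleton_subset_iff.2 hz)
  covers_start := hs.covers_start_of_extends (s.add_extends F z)

theorem Sweep.induct_extends {ι : Type} {step : ι → State n → State n → Prop}
    {F : E n → Fin m → ℝ} {p : State n → Prop} {L : List ι} {s t : State n}
    (h : Sweep step L s t) (hstep : ∀ a ∈ L, ∀ s t, p s → step a s t → p t ∧ t.Extends F s)
    (hs : p s) : p t ∧ t.Extends F s := by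
  induction h with
  | nil s => exact ⟨hs, State.Extends.refl s⟩
  | cons h₁ _ ih =>
    obtain ⟨h₂, h₃⟩ := hstep _ List.mem_cons_self _ _ hs h₁
    obtain ⟨h₄, h₅⟩ := ih (fun a ha => hstep a (List.mem_cons_of_mem _ ha)) h₂
    exact ⟨h₄, h₅.trans h₃⟩

/-! ### Generated points stay in the level union -/

namespace Params
variable {P : Params n m} {x₀ : E n}

theorem mem_levelUnion {x : E n} :
    x ∈ P.levelUnion x₀ ↔ ∃ j, x ∈ P.Ω ∧ P.F x j ≤ P.F x₀ j := by
  simp [levelUnion]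

theorem levelUnion_subset : P.levelUnion x₀ ⊆ P.Ω := fun _ hx =>
  (mem_levelUnion.1 hx).choose_spec.1

theorem stepSize_pos (hα₀ : 0 < P.α₀ ∧ P.α₀ ≤ 1) (hδ : 0 < P.δ ∧ P.δ < 1) (h : ℕ) :
    0 < P.α₀ * P.δ ^ h := mul_pos hα₀.1 (pow_pos hδ.1 h)

theorem stepSize_le_one (hα₀ : 0 < P.α₀ ∧ P.α₀ ≤ 1) (hδ : 0 < P.δ ∧ P.δ < 1) (h : ℕ) :
    P.α₀ * P.δ ^ h ≤ 1 :=
  mul_le_one₀ hα₀.2 (pow_nonneg hδ.1.le h) (pow_le_one₀ hδ.1.le hδ.2.le)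

theorem add_smul_vI_mem_Ω (hF : ContDiff ℝ 1 P.F) (hα₀ : 0 < P.α₀ ∧ P.α₀ ≤ 1)
    (hδ : 0 < P.δ ∧ P.δ < 1) {I : Finset (Fin m)} (hI : I.Nonempty) {x : E n} (hx : x ∈ P.Ω)
    (h : ℕ) : x + (P.α₀ * P.δ ^ h) • P.vI I x ∈ P.Ω :=
  P.add_smul_mem_Ω hx (vI_spec hF hI hx).1 (stepSize_pos hα₀ hδ h).le (stepSize_le_one hα₀ hδ h)

/-- `X̂` holds a point `c` with `F c ≤ F x₀`. The partial line search makes the new point beat `c`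
in some objective, which places it in the level union. -/
theorem EnrichStep.admissible (hF : ContDiff ℝ 1 P.F) (hα₀ : 0 < P.α₀ ∧ P.α₀ ≤ 1)
    (hδ : 0 < P.δ ∧ P.δ < 1) {z : E n} (hz : z ∈ P.Ω) {I : Finset (Fin m)} (hI : I.Nonempty)
    {s t : State n} (hs : s.Admissible P.F (P.levelUnion x₀) x₀) (h : P.EnrichStep z I s t) :
    t.Admissible P.F (P.levelUnion x₀) x₀ ∧ t.Extends P.F s := by
  by_cases hzs : z ∈ s.Xhat
  · obtain ⟨_, ⟨⟨k, rfl, hα⟩, -⟩, rfl⟩ := h.1 hzs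
    refine ⟨hs.add ?_, s.add_extends _ _⟩
    obtain ⟨c, hc, hcx⟩ := hs.covers_start
    obtain ⟨j, hj⟩ := hα c hc
    exact mem_levelUnion.2 ⟨j, add_smul_vI_mem_Ω hF hα₀ hδ hI hz k, hj.le.trans (hcx j)⟩
  · rw [h.2 hzs]
    exact ⟨hs, State.Extends.refl s⟩

/-- The outcome of the line search of phase 1 at a point of negative `θ`. -/
theorem LineSearch.exists_step {Xhat : Set (E n)} {x : E n} {α : ℝ} (h : P.LineSearch Xhat x α) :
    ∃ k : ℕ, α = P.α₀ * P.δ ^ k ∧ ∃ c, (c ∈ Xhat ∨ c = x) ∧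
      ∀ j, P.F (x + α • P.v x) j ≤ P.F c j + P.γ * α * P.D x (P.v x) := by
  by_cases hc : ∃ c ∈ Xhat, P.F x ≤ P.F c
  · obtain ⟨⟨k, hk, c, hc, -, h'⟩, -⟩ := h.1 hc
    exact ⟨k, hk, c, Or.inl hc, h'⟩
  · obtain ⟨⟨k, hk, h'⟩, -⟩ := h.2 hc
    exact ⟨k, hk, x, Or.inr rfl, h'⟩

/-- The sufficient decrease is measured from a point `c` of the level union and `D ≤ 0`, so the
objective that places `c` there also places the new point there. -/
theorem RefineStepSize.mem_levelUnion (hm : 0 < m) (hF : ContDiff ℝ 1 P.F)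
    (hα₀ : 0 < P.α₀ ∧ P.α₀ ≤ 1) (hδ : 0 < P.δ ∧ P.δ < 1) (hγ : 0 < P.γ) {σ : ℝ}
    {Xhat : Set (E n)} (hXhat : Xhat ⊆ P.levelUnion x₀) {x : E n} (hx : x ∈ P.levelUnion x₀)
    {α : ℝ} (h : P.RefineStepSize σ Xhat x α) : x + α • P.v x ∈ P.levelUnion x₀ := by
  have hI : (Finset.univ : Finset (Fin m)).Nonempty := ⟨⟨0, hm⟩, Finset.mem_univ _⟩
  by_cases hθ : P.θ x < -σ
  · obtain ⟨k, rfl, c, hc, hle⟩ := (h.1 hθ).exists_step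
    have hcL : c ∈ P.levelUnion x₀ := hc.elim (fun h => hXhat h) (fun h => h ▸ hx)
    obtain ⟨j, -, hj⟩ := Params.mem_levelUnion.1 hcL
    have hxΩ := levelUnion_subset hx
    have hD : P.D x (P.v x) ≤ 0 := (maxSlope_vI_le hF hI hxΩ).trans (θI_nonpos hF hI hxΩ)
    have hneg : P.γ * (P.α₀ * P.δ ^ k) * P.D x (P.v x) ≤ 0 :=
      mul_nonpos_of_nonneg_of_nonpos (mul_pos hγ (stepSize_pos hα₀ hδ k)).le hD
    exact Params.mem_levelUnion.2
      ⟨j, add_smul_vI_mem_Ω hF hα₀ hδ hI hxΩ k, by linarith [hle j]⟩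
  · rw [h.2 hθ, zero_smul, add_zero]
    exact hx

/-- The first transition of `ProcessPoint` at a point that is not skipped. -/
theorem ProcessPoint.exists_add (hm : 0 < m) (hF : ContDiff ℝ 1 P.F)
    (hα₀ : 0 < P.α₀ ∧ P.α₀ ≤ 1) (hδ : 0 < P.δ ∧ P.δ < 1) (hγ : 0 < P.γ) {σ : ℝ} {x : E n}
    (hx : x ∈ P.levelUnion x₀) {s t : State n} (hs : s.Admissible P.F (P.levelUnion x₀) x₀)
    (h : P.ProcessPoint σ x s t) (hskip : ¬ ∃ y ∈ s.Xhat, Dominates P.F y x) :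
    ∃ α, P.RefineStepSize σ s.Xhat x α ∧ t.Admissible P.F (P.levelUnion x₀) x₀ ∧
      t.Extends P.F (s.add P.F (x + α • P.v x)) := by
  obtain ⟨α, z, Is, hα, rfl, -, hIs, hsweep⟩ := h.1 hskip
  have hz := hα.mem_levelUnion hm hF hα₀ hδ hγ (hs.Xhat_subset.trans hs.gen_subset) hx
  exact ⟨α, hα, hsweep.induct_extends (fun I hI s t hs hst =>
    EnrichStep.admissible hF hα₀ hδ (levelUnion_subset hz) ((hIs I).1 hI).1 hs hst) (hs.add hz)⟩

theorem ProcessPoint.admissible (hm : 0 < m) (hF : ContDiff ℝ 1 P.F)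
    (hα₀ : 0 < P.α₀ ∧ P.α₀ ≤ 1) (hδ : 0 < P.δ ∧ P.δ < 1) (hγ : 0 < P.γ) {σ : ℝ} {x : E n}
    (hx : x ∈ P.levelUnion x₀) {s t : State n} (hs : s.Admissible P.F (P.levelUnion x₀) x₀)
    (h : P.ProcessPoint σ x s t) :
    t.Admissible P.F (P.levelUnion x₀) x₀ ∧ t.Extends P.F s := by
  by_cases hskip : ∃ y ∈ s.Xhat, Dominates P.F y x
  · rw [h.2 hskip]
    exact ⟨hs, State.Extends.refl s⟩
  · obtain ⟨α, -, h₁, h₂⟩ := ProcessPoint.exists_add hm hF hα₀ hδ hγ hx hs h hskip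
    exact ⟨h₁, h₂.trans (s.add_extends _ _)⟩

end Params

/-! ### Invariants of a run -/

namespace Run
variable {P : Params n m} (R : Run P)

theorem finite_X (k : ℕ) : (R.X k).Finite :=
  (R.order k).finite_toSet.subset fun x hx => (R.mem_order k x).2 hx

theorem Cbar_subset_C (k : ℕ) : R.Cbar k ⊆ R.C k := by
  rw [R.C_eq k]
  exact Set.subset_union_left

theorem C_subset (k : ℕ) : R.C k ⊆ R.Cbar k ∪ R.X k := by
  rw [R.C_eq k]
  exact Set.union_subset_union_right _ fun _ hx => hx.1

/-- Every point of `X^k` weakly dominates a point of `C^k`. -/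
theorem exists_ge_mem_C {k : ℕ} {x : E n} (hx : x ∈ R.X k) : ∃ c ∈ R.C k, P.F x ≤ P.F c := by
  by_cases h : ∃ c ∈ R.Cbar k, P.F x ≤ P.F c
  · obtain ⟨c, hc, hxc⟩ := h
    exact ⟨c, R.Cbar_subset_C k hc, hxc⟩
  -- With no point of `C̄^k` weakly above it, `x` itself passes the filter that adds points of `X^k`
  -- to `C^k`.
  · refine ⟨x, ?_, le_rfl⟩
    rw [R.C_eq k]
    refine Or.inr ⟨hx, fun y hy => ?_⟩
    by_contra! h'
    exact h ⟨y, hy, h'⟩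

theorem l_zero : R.l 0 = 0 := Nat.le_zero.1 (R.l_range 0).1

/-- The facts that hold at the start of every iteration. -/
theorem invariants (hm : 0 < m) (hF : ContDiff ℝ 1 P.F)
    (hα₀ : 0 < P.α₀ ∧ P.α₀ ≤ 1) (hδ : 0 < P.δ ∧ P.δ < 1) (hγ : 0 < P.γ) (hX0 : R.X 0 ⊆ P.Ω)
    (hX0nd : MutuallyNondominated P.F (R.X 0)) {x₀ : E n} (hx₀ : x₀ ∈ R.X 0) (k : ℕ) :
    State.Admissible P.F (P.levelUnion x₀) x₀ ⟨R.C k, R.gen k⟩ ∧ ∀ i ≤ k, R.X i ⊆ R.gen k := by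
  induction k with
  | zero =>
    have hCbar : R.Cbar 0 = R.X 0 := by
      rw [R.Cbar_zero, R.l_zero, Set.union_empty]
      exact Set.Subset.antisymm nondominatedPart_subset fun x hx => ⟨hx, hX0nd x hx⟩
    have hC : R.C 0 = R.X 0 :=
      Set.Subset.antisymm ((R.C_subset 0).trans (by rw [hCbar, Set.union_self]))
        (hCbar ▸ R.Cbar_subset_C 0)
    refine ⟨⟨?_, ?_, ?_, ⟨x₀, ?_, le_rfl⟩⟩, ?_⟩
    · exact R.gen_zero ▸ R.finite_X 0
    · simp only [hC, R.gen_zero, subset_rfl]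
    · simp only [R.gen_zero]
      intro x hx
      by_contra hxL
      refine hX0nd x hx x₀ hx₀ ?_
      -- A feasible point outside the level union is strictly worse than `x₀` in every objective,
      -- hence dominated by it.
      have hlt : ∀ j, P.F x₀ j < P.F x j := fun j => by
        by_contra! hj
        exact hxL (Params.mem_levelUnion.2 ⟨j, hX0 hx, hj⟩)
      exact ⟨fun j => (hlt j).le, fun heq => (hlt ⟨0, hm⟩).ne (congrFun heq _)⟩
    · simpa only [hC] using hx₀
    · intro i hi
      rw [Nat.le_zero.1 hi, R.gen_zero]
  | succ k ih =>
    obtain ⟨hadm, hXgen⟩ := ih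
    obtain ⟨hadm', hext⟩ := (R.sweep k).induct_extends (fun x hx s t hs hst =>
      Params.ProcessPoint.admissible hm hF hα₀ hδ hγ
        (hadm.gen_subset (hXgen k le_rfl ((R.mem_order k x).1 hx))) hs hst) hadm
    have hgen : R.gen k ⊆ R.gen (k + 1) := hext.2
    have hX : ∀ i ≤ k + 1, R.X i ⊆ R.gen (k + 1) := by
      intro i hi
      rcases Nat.of_le_succ hi with hi | rfl
      · exact (hXgen i hi).trans hgen
      · rw [R.X_succ]
        refine nondominatedPart_subset.trans (Set.union_subset hadm'.Xhat_subset ?_)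
        rcases R.Xbar_mem k with h | ⟨i, hi, -, h⟩
        · rw [h]; exact hadm'.Xhat_subset
        · rw [h]; exact (hXgen i hi).trans hgen
    have hunion : R.X (R.l (k + 1)) ∪ R.C k ⊆ R.gen (k + 1) :=
      Set.union_subset (hX _ (R.l_range _).1) (hadm.Xhat_subset.trans hgen)
    refine ⟨⟨hadm'.finite_gen, ?_, hadm'.gen_subset, ?_⟩, hX⟩
    · refine (R.C_subset _).trans (Set.union_subset ?_ (hX _ le_rfl))
      rw [R.Cbar_succ]
      exact nondominatedPart_subset.trans hunion
    · obtain ⟨c, hc, hcx⟩ := hadm.covers_start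
      obtain ⟨a, ha, hac⟩ := covers_nondominatedPart (F := P.F) (hadm'.finite_gen.subset hunion) c
        (Or.inr hc)
      rw [← R.Cbar_succ] at ha
      exact ⟨a, R.Cbar_subset_C _ ha, hac.trans hcx⟩

end Run

/-! ### Hyper-volume estimates -/

theorem hypervolume_mono_ref (F : E n → Fin m → ℝ) {ζ ζ' : Fin m → ℝ} (h : ζ ≤ ζ')
    (S : Set (E n)) : hypervolume F ζ S ≤ hypervolume F ζ' S :=
  measure_mono fun _ ⟨b, hb, h₁, h₂⟩ => ⟨b, hb, h₁, h₂.trans h⟩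

theorem Covers.dominatedRegion_subset {F : E n → Fin m → ℝ} {A B : Set (E n)}
    (h : Covers F A B) (ζ : Fin m → ℝ) :
    dominatedRegion ζ (F '' B) ⊆ dominatedRegion ζ (F '' A) := by
  rintro y ⟨_, ⟨b, hb, rfl⟩, h₁, h₂⟩
  obtain ⟨a, ha, hab⟩ := h b hb
  exact ⟨_, ⟨a, ha, rfl⟩, hab.trans h₁, h₂⟩

theorem Covers.hypervolume_le {F : E n → Fin m → ℝ} {A B : Set (E n)} (h : Covers F A B)
    (ζ : Fin m → ℝ) : hypervolume F ζ B ≤ hypervolume F ζ A :=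
  measure_mono (h.dominatedRegion_subset ζ)

/-- If `A` covers `B` and a point that improves every objective of the locally nondominated point
`c` by `η`, then the hyper-volume of `A` exceeds that of `B` by `η ^ m`. -/
theorem Covers.hypervolume_add_le (hm : 0 < m) {F : E n → Fin m → ℝ} {A B : Set (E n)}
    (h : Covers F A B) {ζ : Fin m → ℝ} {c z : E n} {η : ℝ} (hz : ∃ a ∈ A, F a ≤ F z)
    (hzc : ∀ j, F z j ≤ F c j - η) (hc : F c ≤ ζ) (hB : ∀ b ∈ B, F b ≤ F c → F b = F c) :
    hypervolume F ζ B + ENNReal.ofReal η ^ m ≤ hypervolume F ζ A := by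
  set box : Set (Fin m → ℝ) := Set.pi Set.univ fun j => Set.Ico (F c j - η) (F c j) with hbox
  have hvol : volume box = ENNReal.ofReal η ^ m := by
    rw [hbox, volume_pi_pi]
    simp
  have hmeas : MeasurableSet box := MeasurableSet.univ_pi fun _ => measurableSet_Ico
  -- A `b` below a point of the box is below `c`, so `F b = F c`; but points of the box are strictly
  -- below `F c`.
  have hdisj : Disjoint (dominatedRegion ζ (F '' B)) box := by
    rw [Set.disjoint_left]
    rintro w ⟨_, ⟨b, hb, rfl⟩, hbw, -⟩ hw
    have hwc : ∀ j, w j < F c j := fun j => (hw j trivial).2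
    have heq := hB b hb (hbw.trans fun j => (hwc j).le)
    exact (hwc ⟨0, hm⟩).not_ge (heq ▸ hbw ⟨0, hm⟩)
  rw [← hvol, hypervolume, ← measure_union hdisj hmeas]
  refine measure_mono (Set.union_subset (h.dominatedRegion_subset ζ) fun w hw => ?_)
  obtain ⟨a, ha, haz⟩ := hz
  exact ⟨_, ⟨a, ha, rfl⟩, fun j => (haz j).trans ((hzc j).trans (hw j trivial).1),
    fun j => (hw j trivial).2.le.trans (hc j)⟩

theorem le_refPoint (F : E n → Fin m → ℝ) {A : Set (E n)} (hA : A.Finite) {x : E n}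
    (hx : x ∈ A) : F x ≤ refPoint F A := fun _ =>
  le_csSup (hA.image _).bddAbove ⟨x, hx, rfl⟩

theorem refPoint_mono (F : E n → Fin m → ℝ) {A B : Set (E n)} (hA : A.Nonempty) (hB : B.Finite)
    (h : A ⊆ B) : refPoint F A ≤ refPoint F B := fun _ =>
  csSup_le_csSup (hB.image _).bddAbove (hA.image _) (Set.image_mono h)

/-- Hyper-volumes of subsets of a compact set are uniformly bounded. -/
theorem exists_hypervolume_bound {F : E n → Fin m → ℝ} (hF : Continuous F) {L : Set (E n)}
    (hL : IsCompact L) : ∃ B : ENNReal, B < ⊤ ∧ ∀ A ⊆ L, A.Nonempty → ∀ S ⊆ L,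
      hypervolume F (refPoint F A) S ≤ B := by
  have hFj : ∀ j, ContinuousOn (fun x => F x j) L := fun j =>
    (continuous_pi_iff.1 hF j).continuousOn
  choose a ha using fun j => (hL.image_of_continuousOn (hFj j)).bddBelow
  choose b hb using fun j => (hL.image_of_continuousOn (hFj j)).bddAbove
  refine ⟨volume (Set.Icc a b), isCompact_Icc.measure_lt_top, fun A hA hAne S hS => ?_⟩
  refine measure_mono ?_
  rintro y ⟨_, ⟨s, hs, rfl⟩, h₁, h₂⟩
  refine ⟨fun j => (ha j ⟨s, hS hs, rfl⟩).trans (h₁ j), fun j => (h₂ j).trans ?_⟩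
  -- Nonemptiness of `A` excludes the default value 0 of the supremum.
  refine csSup_le (hAne.image _) ?_
  rintro _ ⟨x, hx, rfl⟩
  exact hb j ⟨x, hA hx, rfl⟩

/-! ### Covering relations along a run -/

namespace Run
variable {P : Params n m} (R : Run P) {x₀ : E n}

/-- The facts of `Run.invariants`, for all iterations. -/
def Invariant (x₀ : E n) : Prop := ∀ k,
  State.Admissible P.F (P.levelUnion x₀) x₀ ⟨R.C k, R.gen k⟩ ∧ ∀ i ≤ k, R.X i ⊆ R.gen k

variable {R}

theorem Invariant.finite_gen (h : R.Invariant x₀) (k : ℕ) : (R.gen k).Finite := (h k).1.finite_gen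

theorem Invariant.X_subset_gen (h : R.Invariant x₀) {i k : ℕ} (hik : i ≤ k) :
    R.X i ⊆ R.gen k := (h k).2 i hik

theorem Invariant.X_subset_levelUnion (h : R.Invariant x₀) (k : ℕ) :
    R.X k ⊆ P.levelUnion x₀ := (h.X_subset_gen le_rfl).trans (h k).1.gen_subset

theorem Invariant.C_subset_gen (h : R.Invariant x₀) (k : ℕ) : R.C k ⊆ R.gen k :=
  (h k).1.Xhat_subset

theorem Invariant.gen_nonempty (h : R.Invariant x₀) (k : ℕ) : (R.gen k).Nonempty := by
  obtain ⟨c, hc, -⟩ := (h k).1.covers_start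
  exact ⟨c, h.C_subset_gen k hc⟩

theorem Invariant.sweep_spec (h : R.Invariant x₀) (hm : 0 < m) (hF : ContDiff ℝ 1 P.F)
    (hα₀ : 0 < P.α₀ ∧ P.α₀ ≤ 1) (hδ : 0 < P.δ ∧ P.δ < 1) (hγ : 0 < P.γ) (k : ℕ) {L : List (E n)}
    {s : State n} (hL : ∀ x ∈ L, x ∈ R.X k)
    (hs : s.Admissible P.F (P.levelUnion x₀) x₀) {t : State n}
    (hst : Sweep (P.ProcessPoint (P.σ k)) L s t) :
    t.Admissible P.F (P.levelUnion x₀) x₀ ∧ t.Extends P.F s :=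
  hst.induct_extends (fun x hx _ _ hs hst => Params.ProcessPoint.admissible hm hF hα₀ hδ hγ
    (h.X_subset_levelUnion k (hL x hx)) hs hst) hs

theorem Invariant.extends_sweep (h : R.Invariant x₀) (hm : 0 < m) (hF : ContDiff ℝ 1 P.F)
    (hα₀ : 0 < P.α₀ ∧ P.α₀ ≤ 1) (hδ : 0 < P.δ ∧ P.δ < 1) (hγ : 0 < P.γ) (k : ℕ) :
    State.Extends P.F ⟨R.Xhat k, R.gen (k + 1)⟩ ⟨R.C k, R.gen k⟩ :=
  (h.sweep_spec hm hF hα₀ hδ hγ k (fun x hx => (R.mem_order k x).1 hx) (h k).1 (R.sweep k)).2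

theorem Invariant.covers_X_succ (h : R.Invariant x₀) (hm : 0 < m) (hF : ContDiff ℝ 1 P.F)
    (hα₀ : 0 < P.α₀ ∧ P.α₀ ≤ 1) (hδ : 0 < P.δ ∧ P.δ < 1) (hγ : 0 < P.γ) (k : ℕ) :
    Covers P.F (R.X (k + 1)) (R.Xhat k ∪ R.Xbar k) := by
  have hfin : (R.Xhat k).Finite := by
    have := h.sweep_spec hm hF hα₀ hδ hγ k (fun x hx => (R.mem_order k x).1 hx) (h k).1 (R.sweep k)
    exact this.1.finite_gen.subset this.1.Xhat_subset
  rw [R.X_succ]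
  refine covers_nondominatedPart (hfin.union ?_)
  rcases R.Xbar_mem k with hk | ⟨i, -, -, hk⟩
  · rwa [hk]
  · rw [hk]; exact R.finite_X i

/-- This is where `SameSet` enters: `X^{k+1}` covers `Xbar^k = X^{l(k+1)}` as well as `X̂^k`, which
covers `C^k`; these are the two sets from which `C̄^{k+1}` is filtered. -/
theorem covers_X_C (h : R.Invariant x₀) (hm : 0 < m) (hF : ContDiff ℝ 1 P.F)
    (hα₀ : 0 < P.α₀ ∧ P.α₀ ≤ 1) (hδ : 0 < P.δ ∧ P.δ < 1) (hγ : 0 < P.γ) (hsame : R.SameSet)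
    (k : ℕ) : Covers P.F (R.X k) (R.C k) := by
  have hCbar : Covers P.F (R.X k) (R.Cbar k) := by
    cases k with
    | zero =>
      refine Covers.of_subset ?_
      rw [R.Cbar_zero, R.l_zero, Set.union_empty]
      exact nondominatedPart_subset
    | succ k =>
      have hX := h.covers_X_succ hm hF hα₀ hδ hγ k
      have hbar : R.Xbar k = R.X (R.l (k + 1)) := hsame (k + 1) k.succ_pos
      rw [R.Cbar_succ]
      intro b hb
      rcases nondominatedPart_subset hb with hb | hb
      · exact hX b (Or.inr (hbar ▸ hb))
      · obtain ⟨a, ha, hab⟩ := (h.extends_sweep hm hF hα₀ hδ hγ k).1 b hb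
        obtain ⟨a', ha', haa'⟩ := hX a (Or.inl ha)
        exact ⟨a', ha', haa'.trans hab⟩
  intro c hc
  rcases R.C_subset k hc with hc | hc
  · exact hCbar c hc
  · exact ⟨c, hc, le_rfl⟩

theorem mutuallyNondominated_X (hX0nd : MutuallyNondominated P.F (R.X 0)) (k : ℕ) :
    MutuallyNondominated P.F (R.X k) := by
  cases k with
  | zero => exact hX0nd
  | succ k =>
    rw [R.X_succ]
    exact mutuallyNondominated_nondominatedPart _ _

theorem mutuallyNondominated_Cbar (k : ℕ) : MutuallyNondominated P.F (R.Cbar k) := by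
  cases k with
  | zero =>
    rw [R.Cbar_zero]
    exact mutuallyNondominated_nondominatedPart _ _
  | succ k =>
    rw [R.Cbar_succ]
    exact mutuallyNondominated_nondominatedPart _ _

theorem Invariant.covers_Cbar (h : R.Invariant x₀) (k : ℕ) :
    Covers P.F (R.Cbar k) (R.X (R.l k)) := by
  cases k with
  | zero =>
    rw [R.Cbar_zero, Set.union_empty]
    exact covers_nondominatedPart (R.finite_X _)
  | succ k =>
    rw [R.Cbar_succ]
    exact (covers_nondominatedPart ((R.finite_X _).union
      ((h.finite_gen k).subset (h.C_subset_gen k)))).trans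
      (Covers.of_subset Set.subset_union_left)

/-- For `c ∈ C̄^k` this is mutual nondominance. For `c ∈ X^k`, some `a ∈ X^k` lies below `b`, and
nondominance in `X^k` collapses the chain `F a ≤ F b ≤ F c`. -/
theorem eq_of_mem_Cbar_of_le (hX0nd : MutuallyNondominated P.F (R.X 0)) {k : ℕ}
    (hXC : Covers P.F (R.X k) (R.C k)) {b c : E n} (hb : b ∈ R.Cbar k) (hc : c ∈ R.C k)
    (hbc : P.F b ≤ P.F c) : P.F b = P.F c := by
  rcases R.C_subset k hc with hc | hc
  · exact (mutuallyNondominated_Cbar k).eq_of_le hc hb hbc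
  · obtain ⟨a, ha, hab⟩ := hXC b (R.Cbar_subset_C k hb)
    have hac := (mutuallyNondominated_X hX0nd k).eq_of_le hc ha (hab.trans hbc)
    exact le_antisymm hbc (hac ▸ hab)

theorem covers_X_succ_C (h : R.Invariant x₀) (hm : 0 < m) (hF : ContDiff ℝ 1 P.F)
    (hα₀ : 0 < P.α₀ ∧ P.α₀ ≤ 1) (hδ : 0 < P.δ ∧ P.δ < 1) (hγ : 0 < P.γ) (k : ℕ) :
    Covers P.F (R.X (k + 1)) (R.C k) :=
  ((h.covers_X_succ hm hF hα₀ hδ hγ k).trans (Covers.of_subset Set.subset_union_left)).trans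
    (h.extends_sweep hm hF hα₀ hδ hγ k).1

/-- The first processed point of an iteration is not skipped, and the next iterate covers the
point that phase 1 produces from it. -/
theorem exists_first_refinement (h : R.Invariant x₀) (hm : 0 < m) (hF : ContDiff ℝ 1 P.F)
    (hα₀ : 0 < P.α₀ ∧ P.α₀ ≤ 1) (hδ : 0 < P.δ ∧ P.δ < 1) (hγ : 0 < P.γ)
    (hX0nd : MutuallyNondominated P.F (R.X 0)) (hfirst : R.FirstIsArgmin) (hsame : R.SameSet)
    (k : ℕ) : ∃ x ∈ R.X k, (∀ y ∈ R.X k, P.θ x ≤ P.θ y) ∧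
      ∃ α, P.RefineStepSize (P.σ k) (R.C k) x α ∧
        ∃ a ∈ R.X (k + 1), P.F a ≤ P.F (x + α • P.v x) := by
  have hXC := covers_X_C h hm hF hα₀ hδ hγ hsame k
  have hsw := R.sweep k
  have hmem := R.mem_order k
  have hhead := hfirst k
  rcases horder : R.order k with _ | ⟨x, L⟩
  · obtain ⟨c, hc, -⟩ := (h k).1.covers_start
    obtain ⟨a, ha, -⟩ := hXC c hc
    have := (hmem a).2 ha
    simp [horder] at this
  · rw [horder] at hsw hmem hhead
    have hx : x ∈ R.X k := (hmem x).1 List.mem_cons_self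
    refine ⟨x, hx, hhead x rfl, ?_⟩
    cases hsw with
    | cons h₁ h₂ =>
      -- A dominating `y ∈ C^k` would be covered by some `a ∈ X^k`, and nondominance in `X^k` forces
      -- `F a = F y = F x`.
      have hskip : ¬ ∃ y ∈ R.C k, Dominates P.F y x := by
        rintro ⟨y, hy, hyx, hne⟩
        obtain ⟨a, ha, hay⟩ := hXC y hy
        have := (mutuallyNondominated_X hX0nd k).eq_of_le hx ha (hay.trans hyx)
        exact hne (le_antisymm hyx (this ▸ hay))
      obtain ⟨α, hα, ht, hext⟩ := Params.ProcessPoint.exists_add hm hF hα₀ hδ hγ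
        (h.X_subset_levelUnion k hx) (h k).1 h₁ hskip
      refine ⟨α, hα, ?_⟩
      have hext' := (h.sweep_spec hm hF hα₀ hδ hγ k
        (fun y hy => (hmem y).1 (List.mem_cons_of_mem _ hy)) ht h₂).2
      obtain ⟨b, hb, hbz⟩ := (hext'.trans hext).1 _ (State.mem_add P.F _ _)
      obtain ⟨a, ha, hab⟩ := h.covers_X_succ hm hF hα₀ hδ hγ k b (Or.inl hb)
      exact ⟨a, ha, hab.trans hbz⟩

theorem Invariant.refPoint_mono (h : R.Invariant x₀) (hm : 0 < m) (hF : ContDiff ℝ 1 P.F)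
    (hα₀ : 0 < P.α₀ ∧ P.α₀ ≤ 1) (hδ : 0 < P.δ ∧ P.δ < 1) (hγ : 0 < P.γ) :
    Monotone fun k => refPoint P.F (R.gen k) :=
  monotone_nat_of_le_succ fun k => FrontDescent.refPoint_mono P.F (h.gen_nonempty k)
    (h.finite_gen _) (h.extends_sweep hm hF hα₀ hδ hγ k).2

/-! ### Growth of the worst hyper-volume -/

variable (R) in
/-- The hyper-volume of the reference set `X^{l(k)}`, at the reference point of iteration `k`. -/
noncomputable def worstVolume (k : ℕ) : ENNReal := hypervolume P.F (refPoint P.F (R.gen k)) (R.X (R.l k))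

theorem worstVolume_le_X_succ (h : R.Invariant x₀) (hm : 0 < m) (hF : ContDiff ℝ 1 P.F)
    (hα₀ : 0 < P.α₀ ∧ P.α₀ ≤ 1) (hδ : 0 < P.δ ∧ P.δ < 1) (hγ : 0 < P.γ) (k : ℕ) :
    R.worstVolume k ≤ hypervolume P.F (refPoint P.F (R.gen k)) (R.X (k + 1)) :=
  ((covers_X_succ_C h hm hF hα₀ hδ hγ k).trans
    ((Covers.of_subset (R.Cbar_subset_C k)).trans (h.covers_Cbar k))).hypervolume_le _

theorem worstVolume_mono (h : R.Invariant x₀) (hm : 0 < m) (hF : ContDiff ℝ 1 P.F)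
    (hα₀ : 0 < P.α₀ ∧ P.α₀ ≤ 1) (hδ : 0 < P.δ ∧ P.δ < 1) (hγ : 0 < P.γ) :
    Monotone R.worstVolume := by
  refine monotone_nat_of_le_succ fun k => ?_
  refine le_trans ?_ (hypervolume_mono_ref P.F (h.refPoint_mono hm hF hα₀ hδ hγ k.le_succ) _)
  obtain ⟨h₁, h₂⟩ := R.l_range (k + 1)
  -- An index `l(k+1) ≤ k` already belonged to the window of iteration `k`; the only new candidate
  -- is `X^{k+1}`.
  rcases Nat.of_le_succ h₁ with h₃ | h₃
  · exact R.l_argmin k _ h₃ (by omega)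
  · rw [h₃]
    exact worstVolume_le_X_succ h hm hF hα₀ hδ hγ k

/-- As long as `Θ(X^k)` is bounded away from zero, an iteration increases the hyper-volume by a
fixed amount. -/
theorem exists_volume_increase (h : R.Invariant x₀) (hm : 0 < m) (hF : ContDiff ℝ 1 P.F)
    (hα₀ : 0 < P.α₀ ∧ P.α₀ ≤ 1) (hδ : 0 < P.δ ∧ P.δ < 1) (hγ : 0 < P.γ ∧ P.γ < 1)
    (hX0nd : MutuallyNondominated P.F (R.X 0)) (hfirst : R.FirstIsArgmin) (hsame : R.SameSet)
    (hcompact : IsCompact (P.levelUnion x₀)) {ε : ℝ} (hε : 0 < ε) :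
    ∃ e : ENNReal, 0 < e ∧ ∀ k, P.σ k < ε → P.Θ (R.X k) ≤ -ε →
      R.worstVolume k + e ≤ hypervolume P.F (refPoint P.F (R.gen k)) (R.X (k + 1)) := by
  have hI : (Finset.univ : Finset (Fin m)).Nonempty := ⟨⟨0, hm⟩, Finset.mem_univ _⟩
  obtain ⟨p, hp⟩ := Params.exists_uniform_armijo_step hm hF hα₀.1 hδ hγ.2 hcompact
    Params.levelUnion_subset hε
  have ha := Params.stepSize_pos hα₀ hδ p
  have hη : 0 < P.γ * (P.α₀ * P.δ ^ p) * ε := mul_pos (mul_pos hγ.1 ha) hε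
  refine ⟨ENNReal.ofReal (P.γ * (P.α₀ * P.δ ^ p) * ε) ^ m,
    ENNReal.pow_pos (ENNReal.ofReal_pos.2 hη) m, fun k hσ hΘ => ?_⟩
  obtain ⟨x, hx, hmin, α, hα, hz⟩ :=
    exists_first_refinement h hm hF hα₀ hδ hγ.1 hX0nd hfirst hsame k
  have hθ : P.θ x ≤ -ε := by
    refine le_trans (le_csInf (Set.Nonempty.image _ ⟨x, hx⟩) ?_) hΘ
    rintro _ ⟨y, hy, rfl⟩
    exact hmin y hy
  have hxL := h.X_subset_levelUnion k hx
  have hD : P.D x (P.v x) ≤ -ε :=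
    (Params.maxSlope_vI_le hF hI (Params.levelUnion_subset hxL)).trans hθ
  -- A point of `C^k` weakly above `x` exists, so the fallback branch of the line search never
  -- occurs here.
  obtain ⟨c', hc', hxc'⟩ := R.exists_ge_mem_C hx
  have hθσ : P.θ x < -P.σ k := by linarith
  have hα' := (hα.1 hθσ).1 ⟨c', hc', hxc'⟩
  obtain ⟨-, -, c, hc, -, hzc⟩ := hα'.1
  have hp' : ∀ j, P.F (x + (P.α₀ * P.δ ^ p) • P.v x) j ≤
      P.F c' j + P.γ * (P.α₀ * P.δ ^ p) * P.D x (P.v x) := fun j => by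
    linarith [hp x hxL hθ j, hxc' j]
  -- The uniform step passes the test with reference `c'`, so the largest accepted step, possibly
  -- with another reference `c`, is at least as long.
  have hαp : P.α₀ * P.δ ^ p ≤ α := hα'.2 ⟨p, rfl, c', hc', hxc', hp'⟩
  have hXC := covers_X_C h hm hF hα₀ hδ hγ.1 hsame k
  have hcov := (covers_X_succ_C h hm hF hα₀ hδ hγ.1 k).trans
    (Covers.of_subset (R.Cbar_subset_C k))
  -- The gain is measured against `C̄^k` instead of `X^{l(k)}`, because near `c` only `C̄^k` is
  -- known to leave the box undominated.
  refine le_trans (add_le_add_left ((h.covers_Cbar k).hypervolume_le _) _)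
    (hcov.hypervolume_add_le hm hz (fun j => ?_)
      (le_refPoint P.F (h.finite_gen k) (h.C_subset_gen k hc))
      fun b hb hbc => eq_of_mem_Cbar_of_le hX0nd hXC hb hc hbc)
  have h₁ : P.γ * (P.α₀ * P.δ ^ p) * ε ≤ P.γ * α * ε := by
    have := hγ.1
    gcongr
  have h₂ : P.γ * α * P.D x (P.v x) ≤ P.γ * α * (-ε) :=
    mul_le_mul_of_nonneg_left hD (mul_pos hγ.1 (ha.trans_le hαp)).le
  linarith [hzc j]

/-- Along the iterations that precede the reference indices, `Θ` tends to zero from below. -/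
theorem eventually_Θ_gt (h : R.Invariant x₀) (hm : 0 < m) (hF : ContDiff ℝ 1 P.F)
    (hα₀ : 0 < P.α₀ ∧ P.α₀ ≤ 1) (hδ : 0 < P.δ ∧ P.δ < 1) (hγ : 0 < P.γ ∧ P.γ < 1)
    (hσ0 : Tendsto P.σ atTop (𝓝 0))
    (hX0nd : MutuallyNondominated P.F (R.X 0)) (hfirst : R.FirstIsArgmin) (hsame : R.SameSet)
    (hcompact : IsCompact (P.levelUnion x₀)) {ε : ℝ} (hε : 0 < ε) :
    ∀ᶠ k in atTop, (∃ i, R.l i = k + 1) → -ε < P.Θ (R.X k) := by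
  obtain ⟨e, he, hinc⟩ :=
    exists_volume_increase h hm hF hα₀ hδ hγ hX0nd hfirst hsame hcompact hε
  obtain ⟨B, hB, hbound⟩ := exists_hypervolume_bound hF.continuous hcompact
  have hmono := worstVolume_mono h hm hF hα₀ hδ hγ.1
  have hsup : ⨆ k, R.worstVolume k < ⊤ := lt_of_le_of_lt (iSup_le fun k =>
    hbound _ (h k).1.gen_subset (h.gen_nonempty k) _ (h.X_subset_levelUnion _)) hB
  -- Eventually the distance of `worstVolume` to its finite supremum is less than the gain `e`.
  have hev : ∀ᶠ k in atTop, ⨆ i, R.worstVolume i < R.worstVolume k + e :=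
    ((tendsto_atTop_iSup hmono).add_const e).eventually_const_lt
      (ENNReal.lt_add_right hsup.ne he.ne')
  filter_upwards [hev, hσ0.eventually_lt_const hε] with k hk hσk
  rintro ⟨i, hi⟩
  by_contra! hΘ
  have hki : k ≤ i := by have := (R.l_range i).1; omega
  have h₁ := hinc k hσk hΘ
  have h₂ := hypervolume_mono_ref P.F (h.refPoint_mono hm hF hα₀ hδ hγ.1 hki) (R.X (k + 1))
  have h₃ : R.worstVolume i = hypervolume P.F (refPoint P.F (R.gen i)) (R.X (k + 1)) := by
    rw [worstVolume, hi]
  exact (hk.trans_le ((h₁.trans h₂).trans (h₃ ▸ le_iSup R.worstVolume i))).false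

end Run

end FrontDescent

/-! ### Conclusion -/

theorem corollary2 {n m : ℕ} (hm : 0 < m) (P : FrontDescent.Params n m)
    (hF : ContDiff ℝ 1 P.F)
    (hα₀ : 0 < P.α₀ ∧ P.α₀ ≤ 1) (hδ : 0 < P.δ ∧ P.δ < 1) (hγ : 0 < P.γ ∧ P.γ < 1)
    (hσ : ∀ k, 0 ≤ P.σ k) (hσ0 : Tendsto P.σ atTop (𝓝 0))
    (R : FrontDescent.Run P)
    (hX0 : R.X 0 ⊆ P.Ω) (hX0nd : FrontDescent.MutuallyNondominated P.F (R.X 0))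
    (hfirst : R.FirstIsArgmin) (hsame : R.SameSet)
    (x₀ : FrontDescent.E n) (hx₀ : x₀ ∈ R.X 0) (hcompact : IsCompact (P.levelUnion x₀)) :
    (∃ K : Set ℕ, K.Infinite ∧ Tendsto (fun k => P.Θ (R.X k)) (atTop ⊓ 𝓟 K) (𝓝 0)) ∧
    ∀ K : Set ℕ, K.Infinite → Tendsto (fun k => P.Θ (R.X k)) (atTop ⊓ 𝓟 K) (𝓝 0) →
      ∀ x : ℕ → FrontDescent.E n, (∀ k, x k ∈ R.X k) →
        (∃ xbar, MapClusterPt xbar (atTop ⊓ 𝓟 K) x) ∧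
        ∀ xbar, MapClusterPt xbar (atTop ⊓ 𝓟 K) x → P.ParetoStationary xbar ∧ P.θ xbar = 0 := by
  have hinv : R.Invariant x₀ := R.invariants hm hF hα₀ hδ hγ.1 hX0 hX0nd hx₀
  have hI : (Finset.univ : Finset (Fin m)).Nonempty := ⟨⟨0, hm⟩, Finset.mem_univ _⟩
  have hXΩ : ∀ k, ∀ x ∈ R.X k, x ∈ P.Ω := fun k x hx =>
    FrontDescent.Params.levelUnion_subset (hinv.X_subset_levelUnion k hx)
  have hΘ_nonpos : ∀ k, P.Θ (R.X k) ≤ 0 := fun k => Real.sInf_nonpos (by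
    rintro _ ⟨x, hx, rfl⟩
    exact FrontDescent.Params.θI_nonpos hF hI (hXΩ k x hx))
  refine ⟨⟨{k | ∃ i, R.l i = k + 1}, ?_, ?_⟩, fun K hK hlim x hx => ⟨?_, fun xbar hxbar => ?_⟩⟩
  · refine Set.infinite_of_forall_exists_gt fun a => ?_
    have h := (R.l_range (a + 2 + P.M)).2
    -- The shift by `a + 2 + M` gives `l ≥ a + 2`, so the predecessor of `l` still exceeds `a`.
    exact ⟨R.l (a + 2 + P.M) - 1, ⟨a + 2 + P.M, by omega⟩, by omega⟩
  · refine tendsto_order.2 ⟨fun a ha => ?_, fun a ha =>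
      Eventually.of_forall fun k => (hΘ_nonpos k).trans_lt ha⟩
    rw [eventually_inf_principal]
    filter_upwards [FrontDescent.Run.eventually_Θ_gt hinv hm hF hα₀ hδ hγ hσ0 hX0nd hfirst hsame
      hcompact (neg_pos.2 ha)] with k hk hkK
    simpa using hk hkK
  · have : (atTop ⊓ 𝓟 K).NeBot := by
      rw [← Filter.frequently_mem_iff_neBot]
      exact Nat.frequently_atTop_iff_infinite.2 hK
    obtain ⟨xbar, -, h⟩ := hcompact.exists_mapClusterPt_of_frequently (f := x)
      (l := atTop ⊓ 𝓟 K)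
      (Eventually.of_forall fun k => hinv.X_subset_levelUnion k (hx k)).frequently
    exact ⟨xbar, h⟩
  -- An ultrafilter refining the subsequence turns the accumulation point into a limit.
  · obtain ⟨f, hf, hfx⟩ := mapClusterPt_iff_ultrafilter.1 hxbar
    have hθ : Tendsto (fun k => P.θ (x k)) f (𝓝 0) :=
      tendsto_of_tendsto_of_tendsto_of_le_of_le (hlim.mono_left hf) tendsto_const_nhds
        (fun k => csInf_le ((R.finite_X k).image _).bddBelow ⟨x k, hx k, rfl⟩)
        fun k => FrontDescent.Params.θI_nonpos hF hI (hXΩ k _ (hx k))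
    have hzero := FrontDescent.Params.θ_eq_zero_of_tendsto hm hF (fun k => hXΩ k _ (hx k)) hfx hθ
    have hbar : xbar ∈ P.Ω := P.isClosed_Ω.mem_of_tendsto hfx
      (Eventually.of_forall fun k => hXΩ k _ (hx k))
    exact ⟨FrontDescent.Params.paretoStationary_of_θ_eq_zero hm hF hbar hzero, hzero⟩
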